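/- **Conventions.** Let $k$ be a field and let $R=\bigoplus_{i\ge 0}R_i$ be a connected graded associative $k$-algebra ($R_0=k$). Ideals are graded right ideals. For a graded right ideal $L\subseteq R$ put $m_i(L)=\sup\{j : \operatorname{Tor}_i^R(L,k)_j\neq 0\}$ (with $\sup\emptyset=0$), $m(L)=m_0(L)$, and $$D_R(d)=\sup\{m_1(L) : L\subseteq R \text{ a graded right ideal with } m_0(L)\le d\}\in\mathbb N\cup\{\infty\}.$$ A set $\mathbf F$ of finitely generated graded right ideals of $R$ is a *coherent family* if $0\in\mathbf F$, $R_{\ge 1}\in\mathbf F$, and for every $0\ne I\in\mathbf F$ there are $J\in\mathbf F$ with $J\neq I$ and a homogeneous $x\in I$ such that $I=J+xR$, $m(J)\le m(I)$ and $(x:J)=\{a\in R : xa\in J\}\in\mathbf F$. The algebra $R$ is *universally $d$-coherent* if the graded right ideals $I$ with $m(I)\le d$ form a coherent family; it is *universally coherent* if it is universally $d$-coherent for all $d\gg 0$, and *universally Koszul* if it is universally $1$-coherent. Let $F=k\langle x_1,\dots,x_n\rangle$ be a free algebra graded by positive degrees of the generators. Suppose that $R\cong F/I$ as graded algebras and that,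 for some admissible well-order on words, $I$ has a finite Gröbner basis $G$. A word is normal if it contains no leading word of an element of $G$, and $N(f)$ denotes the normal form of $f\in F$. The algebra $R$ is an *algebra with $r$-processing* ($r\ge 0$) if for some such presentation, order and $G$, every two normal words $p,q$ satisfy $N(pq)=N(pq_1)\,q_2$ for some factorization $q=q_1q_2$ with $\deg q_1\le r$ (equivalently, for $q_1$ the longest prefix of $q$ of degree at most $r$). **Proposition.** Let $R$ be a connected graded $k$-algebra. 1. If $R$ is an algebra with $r$-processing, then $D_R(d)\le d+2r$ for all $d\ge 0$. In particular, $D_R(d)\le 2d$ for all $d\gg 0$, and $R$ is universally coherent. 2. If $R$ is generated in degree one and is an algebra with $1$-processing, then $R$ is universally Koszul. 3. If $R$ is a quadratic monomial algebra, that is, $R\cong k\langle x_1,\dots,x_n\rangle/(S)$ with all $x_i$ of degree one and $S$ a set of words of length two, then $R$ is an algebra with $1$-processing and is universally Koszul. -/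

import Mathlib

open scoped TensorProduct

noncomputable section

namespace GradedRight

/-! ### Free algebras, Groebner bases and normal forms -/

/-- The free associative algebra `k⟨x_0, …, x_{n-1}⟩`, with its basis of words. -/
abbrev FreeAlg (k : Type*) [Field k] (n : ℕ) : Type _ := MonoidAlgebra k (FreeMonoid (Fin n))

/-- The word `u`, regarded as a monomial of the free algebra. -/
def mono (k : Type*) [Field k] {n : ℕ} (u : FreeMonoid (Fin n)) : FreeAlg k n :=
  MonoidAlgebra.of k (FreeMonoid (Fin n)) u

/-- The degree of a word when the generator `x_i` has degree `w i`. -/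
def wordDegree {n : ℕ} (w : Fin n → ℕ) (u : FreeMonoid (Fin n)) : ℕ :=
  (u.toList.map w).sum

/-- An admissible order on words: a strict total well-order compatible with multiplication on
both sides. -/
structure WordOrder (n : ℕ) where
  lt : FreeMonoid (Fin n) → FreeMonoid (Fin n) → Prop
  trans : ∀ a b c, lt a b → lt b c → lt a c
  total : ∀ a b, lt a b ∨ a = b ∨ lt b a
  wf : WellFounded lt
  mul_lt_mul : ∀ a b u v, lt a b → lt (u * a * v) (u * b * v)

/-- `u` is the leading word of `f`. -/
def IsLeadingWord {k : Type*} [Field k] {n : ℕ} (o : WordOrder n) (f : FreeAlg k n)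
    (u : FreeMonoid (Fin n)) : Prop :=
  f.coeff u ≠ 0 ∧ ∀ v, f.coeff v ≠ 0 → v ≠ u → o.lt v u

/-- `G` is a Groebner basis of the two-sided ideal `I`: it is contained in `I`, and the leading
word of every nonzero element of `I` contains the leading word of an element of `G` as a subword. -/
def IsGroebnerBasis {k : Type*} [Field k] {n : ℕ} (o : WordOrder n)
    (I : TwoSidedIdeal (FreeAlg k n)) (G : Set (FreeAlg k n)) : Prop :=
  (∀ g ∈ G, g ∈ I) ∧
    ∀ f ∈ I, ∀ u, IsLeadingWord o f u →
      ∃ g ∈ G, ∃ v, IsLeadingWord o g v ∧ ∃ a b, u = a * v * b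

/-- A word is normal with respect to `G` if it contains no leading word of an element of `G`. -/
def IsNormalWord {k : Type*} [Field k] {n : ℕ} (o : WordOrder n) (G : Set (FreeAlg k n))
    (u : FreeMonoid (Fin n)) : Prop :=
  ∀ g ∈ G, ∀ v, IsLeadingWord o g v → ∀ a b, u ≠ a * v * b

/-- `h` is the normal form `N(f)` of `f`: a linear combination of normal words that is congruent
to `f` modulo `I`. (It exists and is unique when `G` is a Groebner basis of `I`.) -/
def IsNormalForm {k : Type*} [Field k] {n : ℕ} (o : WordOrder n)
    (I : TwoSidedIdeal (FreeAlg k n)) (G : Set (FreeAlg k n)) (f h : FreeAlg k n) : Prop :=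
  (∀ u, h.coeff u ≠ 0 → IsNormalWord o G u) ∧ f - h ∈ I

/-! ### Connected graded algebras and right ideals -/

section

variable {k R : Type*} [Field k] [Ring R] [Algebra k R]

/-- `R = ⨁ R_i` is connected: `R_0 = k`. -/
def IsConnected (𝒜 : ℕ → Submodule k R) : Prop :=
  Function.Injective (algebraMap k R) ∧ ∀ x ∈ 𝒜 0, ∃ c : k, algebraMap k R c = x

/-- `R` is an algebra with `r`-processing: it is a quotient of a finitely generated free algebra,
with homogeneous generators of positive degrees, by an ideal with a finite Groebner basis such that
for all normal words `p`, `q` one has `N(p q) = N(p q₁) q₂` for a prefix `q₁` of `q = q₁ q₂` of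
degree at most `r`. -/
def HasProcessing (𝒜 : ℕ → Submodule k R) (r : ℕ) : Prop :=
  ∃ (n : ℕ) (w : Fin n → ℕ) (π : FreeAlg k n →ₐ[k] R) (o : WordOrder n) (G : Set (FreeAlg k n)),
    (∀ i, 0 < w i) ∧
    Function.Surjective π ∧
    (∀ i, π (mono k (FreeMonoid.of i)) ∈ 𝒜 (w i)) ∧
    G.Finite ∧
    IsGroebnerBasis o (TwoSidedIdeal.ker π) G ∧
    ∀ p q, IsNormalWord o G p → IsNormalWord o G q →
      ∃ q₁ q₂, q = q₁ * q₂ ∧ wordDegree w q₁ ≤ r ∧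
        ∃ h, IsNormalForm o (TwoSidedIdeal.ker π) G (mono k (p * q₁)) h ∧
          IsNormalForm o (TwoSidedIdeal.ker π) G (mono k (p * q)) (h * mono k q₂)

/-- `R` is a quadratic monomial algebra: `k⟨x_0, …, x_{n-1}⟩ / (S)`, with generators of degree one
and `S` a set of words of length two. -/
def IsQuadraticMonomial (𝒜 : ℕ → Submodule k R) : Prop :=
  ∃ (n : ℕ) (π : FreeAlg k n →ₐ[k] R) (S : Set (FreeMonoid (Fin n))),
    Function.Surjective π ∧
    (∀ i, π (mono k (FreeMonoid.of i)) ∈ 𝒜 1) ∧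
    (∀ u ∈ S, u.length = 2) ∧
    TwoSidedIdeal.ker π = TwoSidedIdeal.span (mono k '' S)

/-- `R` is generated as an algebra by its elements of degree one. -/
def GeneratedInDegreeOne (𝒜 : ℕ → Submodule k R) : Prop :=
  Algebra.adjoin k (𝒜 1 : Set R) = ⊤

/-! ### The groups `Tor_0(L, k)_j` and `Tor_1(L, k)_j`

Here `L` is a graded right ideal of `R`, that is, a homogeneous `Rᵐᵒᵖ`-submodule of `R`, and `k` is
the trivial module `R / R_{≥1}`. The graded groups `Tor_i^R(L, k)` are the homology of the reduced
bar complex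
`⋯ → L ⊗ R_{≥1} ⊗ R_{≥1} → L ⊗ R_{≥1} → L → 0`,
with the differentials `m ⊗ a ↦ m a` and `m ⊗ a ⊗ b ↦ m a ⊗ b - m ⊗ a b`. As `k` is a field, its
terms are subspaces of tensor powers of `R`. -/

/-- The degree `j` part of `L`. -/
def bar0 (𝒜 : ℕ → Submodule k R) (L : Submodule Rᵐᵒᵖ R) (j : ℕ) : Submodule k R :=
  L.restrictScalars k ⊓ 𝒜 j

/-- The degree `j` part of `L ⊗ R_{≥1}`. -/
def bar1 (𝒜 : ℕ → Submodule k R) (L : Submodule Rᵐᵒᵖ R) (j : ℕ) : Submodule k (R ⊗[k] R) :=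
  Submodule.span k {z | ∃ p q : ℕ, 0 < q ∧ p + q = j ∧
    ∃ m ∈ bar0 𝒜 L p, ∃ a ∈ 𝒜 q, z = m ⊗ₜ[k] a}

/-- The degree `j` part of `L ⊗ R_{≥1} ⊗ R_{≥1}`. -/
def bar2 (𝒜 : ℕ → Submodule k R) (L : Submodule Rᵐᵒᵖ R) (j : ℕ) :
    Submodule k ((R ⊗[k] R) ⊗[k] R) :=
  Submodule.span k {z | ∃ p q s : ℕ, 0 < q ∧ 0 < s ∧ p + q + s = j ∧
    ∃ m ∈ bar0 𝒜 L p, ∃ a ∈ 𝒜 q, ∃ b ∈ 𝒜 s, z = (m ⊗ₜ[k] a) ⊗ₜ[k] b}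

/-- The differential `m ⊗ a ↦ m a`. -/
def barD1 (k R : Type*) [Field k] [Ring R] [Algebra k R] : R ⊗[k] R →ₗ[k] R :=
  LinearMap.mul' k R

/-- The differential `m ⊗ a ⊗ b ↦ m a ⊗ b - m ⊗ a b`. -/
def barD2 (k R : Type*) [Field k] [Ring R] [Algebra k R] :
    (R ⊗[k] R) ⊗[k] R →ₗ[k] R ⊗[k] R :=
  LinearMap.rTensor R (LinearMap.mul' k R) -
    LinearMap.lTensor R (LinearMap.mul' k R) ∘ₗ (TensorProduct.assoc k R R R).toLinearMap

/-- `Tor_0^R(L, k)_j`. -/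
abbrev Tor0 (𝒜 : ℕ → Submodule k R) (L : Submodule Rᵐᵒᵖ R) (j : ℕ) : Type _ :=
  ↥(bar0 𝒜 L j) ⧸ ((bar1 𝒜 L j).map (barD1 k R)).submoduleOf (bar0 𝒜 L j)

/-- `Tor_1^R(L, k)_j`. -/
abbrev Tor1 (𝒜 : ℕ → Submodule k R) (L : Submodule Rᵐᵒᵖ R) (j : ℕ) : Type _ :=
  ↥(bar1 𝒜 L j ⊓ LinearMap.ker (barD1 k R)) ⧸
    ((bar2 𝒜 L j).map (barD2 k R)).submoduleOf (bar1 𝒜 L j ⊓ LinearMap.ker (barD1 k R))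

/-- `m(L) = m_0(L) = sup {j | Tor_0(L, k)_j ≠ 0}`, the supremum of the degrees of the minimal
homogeneous generators of `L`. -/
def m0 (𝒜 : ℕ → Submodule k R) (L : Submodule Rᵐᵒᵖ R) : ℕ∞ :=
  ⨆ (j : ℕ) (_ : Nontrivial (Tor0 𝒜 L j)), (j : ℕ∞)

/-- `m_1(L) = sup {j | Tor_1(L, k)_j ≠ 0}`, the supremum of the degrees of the minimal relations
of `L`. -/
def m1 (𝒜 : ℕ → Submodule k R) (L : Submodule Rᵐᵒᵖ R) : ℕ∞ :=
  ⨆ (j : ℕ) (_ : Nontrivial (Tor1 𝒜 L j)), (j : ℕ∞)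

/-- `D_R(d) = sup {m_1(L) | L a graded right ideal of R with m_0(L) ≤ d}`. -/
def syzygyBound (𝒜 : ℕ → Submodule k R) [GradedAlgebra 𝒜] (d : ℕ) : ℕ∞ :=
  ⨆ (L : Submodule Rᵐᵒᵖ R) (_ : L.IsHomogeneous 𝒜) (_ : m0 𝒜 L ≤ d), m1 𝒜 L

/-! ### Coherent families -/

/-- The right ideal `R_{≥1}`. -/
def irrelevant (𝒜 : ℕ → Submodule k R) : Submodule Rᵐᵒᵖ R :=
  Submodule.span Rᵐᵒᵖ {x | ∃ i : ℕ, 0 < i ∧ x ∈ 𝒜 i}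

/-- The right ideal `(x : J) = {a | x a ∈ J}`. -/
def colon (x : R) (J : Submodule Rᵐᵒᵖ R) : Submodule Rᵐᵒᵖ R :=
  J.comap (LinearMap.mulLeft Rᵐᵒᵖ x)

/-- `F` is a coherent family of finitely generated graded right ideals. -/
structure IsCoherentFamily (𝒜 : ℕ → Submodule k R) [GradedAlgebra 𝒜]
    (F : Set (Submodule Rᵐᵒᵖ R)) : Prop where
  homogeneous : ∀ I ∈ F, I.IsHomogeneous 𝒜
  fg : ∀ I ∈ F, I.FG
  bot_mem : ⊥ ∈ F
  irrelevant_mem : irrelevant 𝒜 ∈ F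
  step : ∀ I ∈ F, I ≠ ⊥ → ∃ J ∈ F, J ≠ I ∧ ∃ x ∈ I, SetLike.IsHomogeneousElem 𝒜 x ∧
    I = J ⊔ Submodule.span Rᵐᵒᵖ {x} ∧ m0 𝒜 J ≤ m0 𝒜 I ∧ colon x J ∈ F

/-- `R` is universally `d`-coherent: the graded right ideals generated in degrees at most `d` form
a coherent family. -/
def UniversallyDCoherent (𝒜 : ℕ → Submodule k R) [GradedAlgebra 𝒜] (d : ℕ) : Prop :=
  IsCoherentFamily 𝒜 {I | I.IsHomogeneous 𝒜 ∧ m0 𝒜 I ≤ d}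

/-- `R` is universally coherent: it is universally `d`-coherent for all `d ≫ 0`. -/
def UniversallyCoherent (𝒜 : ℕ → Submodule k R) [GradedAlgebra 𝒜] : Prop :=
  ∀ᶠ d in Filter.atTop, UniversallyDCoherent 𝒜 d

/-- `R` is universally Koszul: it is universally `1`-coherent. -/
def UniversallyKoszul (𝒜 : ℕ → Submodule k R) [GradedAlgebra 𝒜] : Prop :=
  UniversallyDCoherent 𝒜 1

end

end GradedRight

end

open scoped TensorProduct

noncomputable section

namespace GradedRight

/-! ### Words -/

section Words

variable {n : ℕ} (w : Fin n → ℕ)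

/-! Normal words form a `k`-basis of `R`. Cut each normal word `u` at degree `D`, as `u = a t` with
`a` the longest prefix of degree at most `D`; extended linearly, this writes every `c ∈ R` as `∑ c_t
t` (`split`, `sum_split`). Processing makes the cut compatible with left multiplication: for `g` of
degree `p` with `p + r ≤ D`, cutting `g c` at `D` amounts to cutting `c` at `D - p` and multiplying
each coefficient by `g` (`split_mul`). Indeed, rewriting `g c` only touches the first `r` degrees of
the words of `c`, and these lie before the cut.

Two consequences carry the theorem. Let `J` be generated in degrees at most `e = deg x`. Cutting at
`e + r` keeps the coefficients of elements of `J` in `J`, so if `x a ∈ J` then `x a_t ∈ J` for the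
coefficients `a_t` of `a` cut at `r`. Hence `(x : J)` is generated in degrees at most `r`
(`m0_colon_le`). If instead `L` is generated in degrees at most `d`, the cut at `d + r` is a
contracting homotopy of the bar complex of `L` in degrees above `d + r`, so the relations of `L`
live in degrees at most `d + r` (`m1_le`).

Coherence follows by removing a minimal generator `x` of top degree from `I`
(`exists_remove_generator`): the colon ideal is then generated in degrees at most `r ≤ d`. For
quadratic monomial algebras, a relation that appears in a product of two normal words straddles the
junction, so one letter of the right factor decides (`IsQuadraticMonomial.hasProcessing`). -/

@[simp] theorem wordDegree_one : wordDegree w 1 = 0 := rfl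

@[simp] theorem wordDegree_of (i : Fin n) : wordDegree w (FreeMonoid.of i) = w i := by
  simp [wordDegree]

@[simp] theorem wordDegree_mul (u v : FreeMonoid (Fin n)) :
    wordDegree w (u * v) = wordDegree w u + wordDegree w v := by
  simp [wordDegree]

variable {w}

theorem length_le_wordDegree (hw : ∀ i, 0 < w i) (u : FreeMonoid (Fin n)) :
    u.length ≤ wordDegree w u := by
  induction u using FreeMonoid.inductionOn' with
  | one => simp
  | of_mul x u ih =>
    have := hw x
    simp only [FreeMonoid.length_mul, FreeMonoid.length_of, wordDegree_mul, wordDegree_of]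
    omega

theorem eq_one_of_wordDegree_eq_zero (hw : ∀ i, 0 < w i) {u : FreeMonoid (Fin n)}
    (hu : wordDegree w u = 0) : u = 1 := by
  have := length_le_wordDegree hw u
  exact FreeMonoid.length_eq_zero.1 (by omega)

theorem finite_setOf_wordDegree_eq (hw : ∀ i, 0 < w i) (d : ℕ) :
    {u : FreeMonoid (Fin n) | wordDegree w u = d}.Finite := by
  refine Set.Finite.subset (List.finite_length_le (Fin n) d) fun u hu ↦ ?_
  have hu' : wordDegree w u = d := hu
  exact (length_le_wordDegree hw u).trans hu'.le

theorem mul_eq_mul_cases {a b c d : FreeMonoid (Fin n)} (h : a * b = c * d) :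
    (∃ e, c = a * e ∧ b = e * d) ∨ ∃ e, a = c * e ∧ d = e * b :=
  List.append_eq_append_iff.1 h

variable (w) in
/-- `a` is the longest prefix of `a * t` whose degree is at most `D`. -/
def IsCut (D : ℕ) (a t : FreeMonoid (Fin n)) : Prop :=
  wordDegree w a ≤ D ∧ ∀ b c, t = b * c → b ≠ 1 → D < wordDegree w (a * b)

theorem IsCut.eq_of_mul_eq {D : ℕ} {a t a' t' : FreeMonoid (Fin n)} (h : IsCut w D a t)
    (h' : IsCut w D a' t') (he : a * t = a' * t') : a = a' ∧ t = t' := by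
  rcases mul_eq_mul_cases he with ⟨e, h1, h2⟩ | ⟨e, h1, h2⟩
  · by_cases hb : e = 1
    · subst hb; simp_all
    · have := h.2 e t' h2 hb
      rw [← h1] at this
      exact absurd h'.1 this.not_ge
  · by_cases hb : e = 1
    · subst hb; simp_all
    · have := h'.2 e t h2 hb
      rw [← h1] at this
      exact absurd h.1 this.not_ge

/-- Being a cut depends on the prefix only through its degree. So `a` may be replaced by any word
`h` of the right degree, such as a word of the normal form of a product `v * a`. -/
theorem IsCut.mul_left {D p : ℕ} (hp : p ≤ D) {a t h : FreeMonoid (Fin n)}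
    (hc : IsCut w (D - p) a t) (hh : wordDegree w h = p + wordDegree w a) : IsCut w D h t := by
  obtain ⟨h1, h2⟩ := hc
  refine ⟨by omega, fun b c hbc hb ↦ ?_⟩
  have := h2 b c hbc hb
  simp only [wordDegree_mul] at *
  omega

/-- By maximality of `a`, the short prefix that processing rewrites lies inside the cut prefix, so
rewriting does not disturb the suffix `t`. -/
theorem IsCut.exists_eq_mul {D r : ℕ} (hr : r ≤ D) {a t q₁ q₂ : FreeMonoid (Fin n)}
    (hc : IsCut w D a t) (hq : wordDegree w q₁ ≤ r) (he : a * t = q₁ * q₂) :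
    ∃ s, a = q₁ * s ∧ q₂ = s * t := by
  rcases mul_eq_mul_cases he with ⟨e, h1, h2⟩ | h
  · by_cases hb : e = 1
    · subst hb; exact ⟨1, by simp_all⟩
    · have := hc.2 e q₂ h2 hb
      rw [← h1] at this
      omega
  · exact h

theorem exists_isCut (D : ℕ) (u : FreeMonoid (Fin n)) :
    ∃ a t, u = a * t ∧ IsCut w D a t := by
  induction u using FreeMonoid.inductionOn' generalizing D with
  | one =>
    refine ⟨1, 1, rfl, by simp, fun b c hbc hb ↦ absurd ?_ hb⟩
    have := congrArg FreeMonoid.length hbc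
    simp only [FreeMonoid.length_one, FreeMonoid.length_mul] at this
    exact FreeMonoid.length_eq_zero.1 (by omega)
  | of_mul x u ih =>
    by_cases hx : w x ≤ D
    · obtain ⟨a, t, rfl, hc⟩ := ih (D - w x)
      exact ⟨FreeMonoid.of x * a, t, by rw [mul_assoc], hc.mul_left hx (by simp)⟩
    · refine ⟨1, FreeMonoid.of x * u, by simp, by simp, fun b c hbc hb ↦ ?_⟩
      rcases mul_eq_mul_cases hbc with ⟨e, h1, -⟩ | ⟨e, h1, -⟩
      · rw [h1]; simp only [one_mul, wordDegree_mul, wordDegree_of]; omega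
      · have := congrArg FreeMonoid.length h1
        simp only [FreeMonoid.length_of, FreeMonoid.length_mul] at this
        have he : e = 1 := by
          by_contra he
          have h3 := mt FreeMonoid.length_eq_zero.1 he
          have h4 := mt FreeMonoid.length_eq_zero.1 hb
          omega
        rw [he, mul_one] at h1
        rw [← h1]; simp only [one_mul, wordDegree_of]; omega

variable (w) in
/-- The longest prefix of `u` whose degree is at most `D`. -/
def cutPrefix (D : ℕ) (u : FreeMonoid (Fin n)) : FreeMonoid (Fin n) :=
  (exists_isCut (w := w) D u).choose

variable (w) in
/-- The suffix of `u` that is left after its longest prefix of degree at most `D`. -/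
def cutSuffix (D : ℕ) (u : FreeMonoid (Fin n)) : FreeMonoid (Fin n) :=
  (exists_isCut (w := w) D u).choose_spec.choose

theorem cutPrefix_mul_cutSuffix (D : ℕ) (u : FreeMonoid (Fin n)) :
    cutPrefix w D u * cutSuffix w D u = u :=
  (exists_isCut D u).choose_spec.choose_spec.1.symm

theorem isCut_cut (D : ℕ) (u : FreeMonoid (Fin n)) :
    IsCut w D (cutPrefix w D u) (cutSuffix w D u) :=
  (exists_isCut D u).choose_spec.choose_spec.2

theorem IsCut.cutPrefix_eq {D : ℕ} {a t : FreeMonoid (Fin n)} (h : IsCut w D a t) :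
    cutPrefix w D (a * t) = a :=
  ((isCut_cut D _).eq_of_mul_eq h (cutPrefix_mul_cutSuffix D _)).1

theorem IsCut.cutSuffix_eq {D : ℕ} {a t : FreeMonoid (Fin n)} (h : IsCut w D a t) :
    cutSuffix w D (a * t) = t :=
  ((isCut_cut D _).eq_of_mul_eq h (cutPrefix_mul_cutSuffix D _)).2

end Words

/-! ### The free algebra -/

section FreeAlg

variable {k : Type*} [Field k] {n : ℕ}

@[simp] theorem coeff_mono (u : FreeMonoid (Fin n)) :
    (mono k u).coeff = Finsupp.single u 1 := rfl

theorem mono_mul (u v : FreeMonoid (Fin n)) : mono k (u * v) = mono k u * mono k v :=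
  map_mul _ _ _

@[simp] theorem mono_one : mono k (1 : FreeMonoid (Fin n)) = 1 := map_one _

theorem sum_coeff_smul_mono (h : FreeAlg k n) :
    ∑ u ∈ h.coeff.support, h.coeff u • mono k u = h := by
  conv_rhs => rw [← MonoidAlgebra.sum_coeff_single h]
  refine Finset.sum_congr rfl fun u _ ↦ ?_
  simp [mono]

theorem linearMap_eq_of_support {M : Type*} [AddCommGroup M] [Module k M]
    {A B : FreeAlg k n →ₗ[k] M} {h : FreeAlg k n}
    (H : ∀ u, h.coeff u ≠ 0 → A (mono k u) = B (mono k u)) : A h = B h := by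
  rw [← sum_coeff_smul_mono h, map_sum, map_sum]
  refine Finset.sum_congr rfl fun u hu ↦ ?_
  rw [map_smul, map_smul, H u (Finsupp.mem_support_iff.1 hu)]

theorem linearMap_mem_of_support {M : Type*} [AddCommGroup M] [Module k M]
    {A : FreeAlg k n →ₗ[k] M} {h : FreeAlg k n} {P : Submodule k M}
    (H : ∀ u, h.coeff u ≠ 0 → A (mono k u) ∈ P) : A h ∈ P := by
  rw [← sum_coeff_smul_mono h, map_sum]
  refine Submodule.sum_mem _ fun u hu ↦ ?_
  rw [map_smul]
  exact P.smul_mem _ (H u (Finsupp.mem_support_iff.1 hu))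

end FreeAlg

/-! ### Algebras with a basis of normal words -/

section Normal

variable {k R : Type*} [Field k] [Ring R] [Algebra k R]

/-- All words in `h` belong to `N`. -/
def SupportedOn {n : ℕ} (N : Set (FreeMonoid (Fin n))) (h : FreeAlg k n) : Prop :=
  ∀ u, h.coeff u ≠ 0 → u ∈ N

/-- The images in `R` of the words in the set `N` form a basis of `R`, and
`r`-processing holds with respect to this basis. -/
structure IsProcessingBasis (𝒜 : ℕ → Submodule k R) (r : ℕ) {n : ℕ} (w : Fin n → ℕ)
    (π : FreeAlg k n →ₐ[k] R) (N : Set (FreeMonoid (Fin n))) : Prop where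
  pos : ∀ i, 0 < w i
  map_mono_mem : ∀ u, π (mono k u) ∈ 𝒜 (wordDegree w u)
  exists_normal : ∀ y, ∃ h, SupportedOn N h ∧ π h = y
  eq_zero : ∀ h, SupportedOn N h → π h = 0 → h = 0
  process : ∀ p ∈ N, ∀ q ∈ N, ∃ q₁ q₂, q = q₁ * q₂ ∧ wordDegree w q₁ ≤ r ∧
    ∃ h, SupportedOn N h ∧ π h = π (mono k (p * q₁)) ∧ SupportedOn N (h * mono k q₂)

theorem supportedOn_mono {n : ℕ} {N : Set (FreeMonoid (Fin n))} {u : FreeMonoid (Fin n)}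
    (hu : u ∈ N) : SupportedOn N (mono k u) := by
  intro v hv
  rw [coeff_mono, Finsupp.single_apply_ne_zero] at hv
  exact hv.1 ▸ hu

theorem SupportedOn.add {n : ℕ} {N : Set (FreeMonoid (Fin n))} {h h' : FreeAlg k n} (H : SupportedOn N h)
    (H' : SupportedOn N h') : SupportedOn N (h + h') := by
  intro u hu
  by_cases h1 : h.coeff u = 0
  · refine H' u fun h2 ↦ hu ?_
    simp [h1, h2]
  · exact H u h1

theorem SupportedOn.smul {n : ℕ} {N : Set (FreeMonoid (Fin n))} {h : FreeAlg k n} (c : k) (H : SupportedOn N h) :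
    SupportedOn N (c • h) := by
  intro u hu
  refine H u fun h1 ↦ hu ?_
  simp [h1]

namespace IsProcessingBasis

variable {𝒜 : ℕ → Submodule k R} {r : ℕ} {n : ℕ} {w : Fin n → ℕ}
  {π : FreeAlg k n →ₐ[k] R} {N : Set (FreeMonoid (Fin n))}
  (S : IsProcessingBasis 𝒜 r w π N)

include S

theorem injOn {h h' : FreeAlg k n} (H : SupportedOn N h) (H' : SupportedOn N h')
    (he : π h = π h') : h = h' := by
  have := S.eq_zero (h + (-1 : k) • h') (H.add (H'.smul _)) (by simp [he])
  rw [neg_one_smul] at this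
  rwa [← sub_eq_add_neg, sub_eq_zero] at this

/-- The normal form of an element of `R`. -/
def nf : R →ₗ[k] FreeAlg k n where
  toFun y := (S.exists_normal y).choose
  map_add' x y := by
    refine S.injOn (S.exists_normal _).choose_spec.1
      ((S.exists_normal _).choose_spec.1.add (S.exists_normal _).choose_spec.1) ?_
    rw [map_add, (S.exists_normal _).choose_spec.2, (S.exists_normal _).choose_spec.2,
      (S.exists_normal _).choose_spec.2]
  map_smul' c y := by
    refine S.injOn (S.exists_normal _).choose_spec.1
      ((S.exists_normal _).choose_spec.1.smul _) ?_
    rw [map_smul, (S.exists_normal _).choose_spec.2, (S.exists_normal _).choose_spec.2]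
    rfl

theorem supportedOn_nf (y : R) : SupportedOn N (S.nf y) := (S.exists_normal y).choose_spec.1

@[simp] theorem map_nf (y : R) : π (S.nf y) = y := (S.exists_normal y).choose_spec.2

theorem nf_map {h : FreeAlg k n} (H : SupportedOn N h) : S.nf (π h) = h :=
  S.injOn (S.supportedOn_nf _) H (S.map_nf _)

/-- Discarding the words of `h` of degree other than `p` corresponds under `π` to the projection
onto degree `p`, which fixes `π h`. Independence of the normal words then shows that nothing was
discarded. -/
theorem wordDegree_eq_of_mem [GradedAlgebra 𝒜] {h : FreeAlg k n} {p : ℕ} (H : SupportedOn N h)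
    (hp : π h ∈ 𝒜 p) {u : FreeMonoid (Fin n)} (hu : h.coeff u ≠ 0) : wordDegree w u = p := by
  classical
  let T : FreeAlg k n →ₗ[k] FreeAlg k n :=
    (MonoidAlgebra.coeffLinearEquiv k).symm.toLinearMap ∘ₗ
      (Finsupp.lsum k fun u ↦ if wordDegree w u = p then Finsupp.lsingle u else 0) ∘ₗ
      (MonoidAlgebra.coeffLinearEquiv k).toLinearMap
  have hT : ∀ v, T (mono k v) = if wordDegree w v = p then mono k v else 0 := by
    intro v
    have : (MonoidAlgebra.coeffLinearEquiv k) (mono k v) = Finsupp.single v (1 : k) := rfl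
    simp only [T, LinearMap.comp_apply, LinearEquiv.coe_coe, this, Finsupp.lsum_single]
    split_ifs
    · rfl
    · simp
  have hTcoeff : ∀ v, (T h).coeff v = if wordDegree w v = p then h.coeff v else 0 := by
    intro v
    let cf : FreeAlg k n →ₗ[k] k :=
      Finsupp.lapply v ∘ₗ (MonoidAlgebra.coeffLinearEquiv k).toLinearMap
    have hcf : ∀ z, cf z = z.coeff v := fun _ ↦ rfl
    have : (cf ∘ₗ T) h = ((if wordDegree w v = p then (1 : k) else 0) • cf) h := by
      refine linearMap_eq_of_support fun u _ ↦ ?_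
      rw [LinearMap.comp_apply, hT, LinearMap.smul_apply, hcf, hcf, coeff_mono]
      by_cases huv : u = v
      · subst huv
        split_ifs <;> simp
      · split_ifs <;> simp [huv]
    rw [LinearMap.comp_apply, LinearMap.smul_apply, hcf, hcf] at this
    rw [this]
    split_ifs <;> simp
  have hTn : SupportedOn N (T h) := by
    intro v hv
    rw [hTcoeff] at hv
    exact H v fun h0 ↦ hv (by simp [h0])
  have hπ : (π.toLinearMap ∘ₗ T) h = (GradedAlgebra.proj 𝒜 p ∘ₗ π.toLinearMap) h := by
    refine linearMap_eq_of_support fun u _ ↦ ?_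
    simp only [LinearMap.comp_apply, hT, AlgHom.toLinearMap_apply, GradedAlgebra.proj_apply]
    have hm := S.map_mono_mem u
    split_ifs with h1
    · subst h1
      rw [DirectSum.decompose_of_mem_same _ hm]
    · rw [DirectSum.decompose_of_mem_ne _ hm h1, map_zero]
  simp only [LinearMap.comp_apply, AlgHom.toLinearMap_apply, GradedAlgebra.proj_apply,
    DirectSum.decompose_of_mem_same _ hp] at hπ
  have := S.injOn hTn H hπ
  by_contra hne
  have h2 := hTcoeff u
  rw [this, if_neg hne] at h2
  exact hu h2

/-- The normal words of degree `p` span the elements of degree `p`. -/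
theorem le_of_forall_word_mem [GradedAlgebra 𝒜] {p : ℕ} {P : Submodule k R}
    (hP : ∀ u ∈ N, wordDegree w u = p → π (mono k u) ∈ P) : 𝒜 p ≤ P := by
  intro y hy
  rw [← S.map_nf y] at hy ⊢
  exact linearMap_mem_of_support (A := π.toLinearMap) fun u hu ↦
    hP u (S.supportedOn_nf y u hu) (S.wordDegree_eq_of_mem (S.supportedOn_nf y) hy hu)

theorem mem_span (y : R) : y ∈ Submodule.span k {z | ∃ u ∈ N, z = π (mono k u)} := by
  rw [← S.map_nf y]
  refine linearMap_mem_of_support (A := π.toLinearMap) fun u hu ↦ Submodule.subset_span ?_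
  exact ⟨u, S.supportedOn_nf y u hu, rfl⟩

/-! ### The splitting operator and left multiplication -/

omit S in
variable (w π) in
/-- The linear map that sends a word `a * t`, with `a` its longest prefix of degree at most `D`,
to the image of `a` in `R`, placed at `t`. -/
def wordSplit (D : ℕ) : FreeAlg k n →ₗ[k] FreeMonoid (Fin n) →₀ R :=
  (Finsupp.lsum k fun u ↦ LinearMap.toSpanSingleton k _
      (Finsupp.single (cutSuffix w D u) (π (mono k (cutPrefix w D u))))) ∘ₗ
    (MonoidAlgebra.coeffLinearEquiv k).toLinearMap

omit S in
theorem wordSplit_mono (D : ℕ) (u : FreeMonoid (Fin n)) : wordSplit w π D (mono k u) =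
    Finsupp.single (cutSuffix w D u) (π (mono k (cutPrefix w D u))) := by
  have : (MonoidAlgebra.coeffLinearEquiv k) (mono k u) = Finsupp.single u (1 : k) := rfl
  simp [wordSplit, this]

/-- The splitting of an element of `R`: its normal form is written as `∑ a_t t`, where `t` runs
over the suffixes that are left after the longest prefix of degree at most `D`. -/
def split (D : ℕ) : R →ₗ[k] FreeMonoid (Fin n) →₀ R := wordSplit w π D ∘ₗ S.nf

theorem split_map (D : ℕ) {h : FreeAlg k n} (H : SupportedOn N h) :
    S.split D (π h) = wordSplit w π D h := by
  rw [split, LinearMap.comp_apply, S.nf_map H]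

theorem split_map_mono (D : ℕ) {u : FreeMonoid (Fin n)} (hu : u ∈ N) :
    S.split D (π (mono k u)) =
      Finsupp.single (cutSuffix w D u) (π (mono k (cutPrefix w D u))) := by
  rw [S.split_map D (supportedOn_mono hu), wordSplit_mono]

/-- Reassembling the splitting of an element. -/
theorem sum_split (D : ℕ) (c : R) : (S.split D c).sum (fun t y ↦ y * π (mono k t)) = c := by
  let A : (FreeMonoid (Fin n) →₀ R) →ₗ[k] R :=
    Finsupp.lsum k fun t ↦ LinearMap.mulRight k (π (mono k t))
  suffices h : A ∘ₗ S.split D = LinearMap.id from LinearMap.congr_fun h c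
  refine LinearMap.ext fun c ↦ ?_
  induction S.mem_span c using Submodule.span_induction with
  | mem x hx =>
    obtain ⟨u, hu, rfl⟩ := hx
    rw [LinearMap.comp_apply, S.split_map_mono D hu]
    simp [A, ← map_mul, ← mono_mul, cutPrefix_mul_cutSuffix]
  | zero => simp
  | add x y _ _ hx hy => rw [map_add, map_add, hx, hy]
  | smul c x _ hx => rw [map_smul, map_smul, hx]

/-- Splitting is compatible with left multiplication. -/
theorem split_mul [GradedAlgebra 𝒜] {p D : ℕ} (hD : p + r ≤ D) {g : R} (hg : g ∈ 𝒜 p) (c : R) :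
    S.split D (g * c) =
      Finsupp.mapRange.linearMap (LinearMap.mulLeft k g) (S.split (D - p) c) := by
  induction S.mem_span c using Submodule.span_induction with
  | mem x hx =>
    obtain ⟨q, hq, rfl⟩ := hx
    rw [S.split_map_mono _ hq]
    simp only [Finsupp.mapRange.linearMap_apply, Finsupp.mapRange_single, LinearMap.mulLeft_apply]
    set a := cutPrefix w (D - p) q with ha
    set t := cutSuffix w (D - p) q with ht
    have hat : a * t = q := cutPrefix_mul_cutSuffix _ _
    have hcut : IsCut w (D - p) a t := isCut_cut _ _
    clear_value a t
    subst hat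
    -- Both sides are linear in `g`, so `g` may be taken to be the image of a normal word `v` of
    -- degree `p`.
    suffices H : 𝒜 p ≤ LinearMap.eqLocus
        (S.split D ∘ₗ LinearMap.mulRight k (π (mono k (a * t))))
        (Finsupp.lsingle t ∘ₗ LinearMap.mulRight k (π (mono k a))) from H hg
    refine S.le_of_forall_word_mem fun v hv hdeg ↦ ?_
    obtain ⟨q₁, q₂, hqq, hq₁, h, hh, hπ, hh₂⟩ := S.process v hv _ hq
    obtain ⟨s, rfl, rfl⟩ := hcut.exists_eq_mul (by omega) hq₁ hqq
    have e1 : π (mono k v) * π (mono k (q₁ * s * t)) = π (h * mono k (s * t)) := by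
      rw [map_mul, hπ]
      simp only [mono_mul, map_mul, mul_assoc]
    have e2 : π (mono k v) * π (mono k (q₁ * s)) = π (h * mono k s) := by
      rw [map_mul, hπ]
      simp only [mono_mul, map_mul, mul_assoc]
    simp only [LinearMap.mem_eqLocus, LinearMap.comp_apply, LinearMap.mulRight_apply]
    rw [e1, S.split_map D hh₂, e2]
    have := linearMap_eq_of_support (h := h)
      (A := wordSplit w π D ∘ₗ LinearMap.mulRight k (mono k (s * t)))
      (B := Finsupp.lsingle t ∘ₗ π.toLinearMap ∘ₗ LinearMap.mulRight k (mono k s)) ?_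
    · simpa using this
    -- All words of the normal form of `v * q₁` have the degree of `v * q₁`, so each `u * s * t` is
    -- cut at `D` exactly between `u * s` and `t`.
    intro u hu
    have hud : wordDegree w u = wordDegree w (v * q₁) :=
      S.wordDegree_eq_of_mem hh (hπ ▸ S.map_mono_mem _) hu
    have hc : IsCut w D (u * s) t := by
      refine hcut.mul_left (by omega) ?_
      simp only [wordDegree_mul] at hud ⊢
      omega
    simp only [LinearMap.comp_apply, LinearMap.mulRight_apply, ← mono_mul, ← mul_assoc]
    rw [wordSplit_mono, hc.cutSuffix_eq, hc.cutPrefix_eq]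
    simp
  | zero => simp
  | add x y _ _ hx hy => rw [mul_add, map_add, map_add, map_add, hx, hy]
  | smul c x _ hx => rw [mul_smul_comm, map_smul, map_smul, map_smul, hx]

theorem split_mul_apply [GradedAlgebra 𝒜] {p D : ℕ} (hD : p + r ≤ D) {g : R} (hg : g ∈ 𝒜 p)
    (c : R) (t : FreeMonoid (Fin n)) : S.split D (g * c) t = g * S.split (D - p) c t := by
  rw [S.split_mul hD hg]
  simp

/-- The components of the splitting of an element of large degree. -/
theorem split_apply_mem [GradedAlgebra 𝒜] {m D : ℕ} (hD : D < m) {c : R} (hc : c ∈ 𝒜 m)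
    (t : FreeMonoid (Fin n)) : S.split D c t = 0 ∨
      0 < wordDegree w t ∧ wordDegree w t ≤ m ∧ m - wordDegree w t ≤ D ∧
        S.split D c t ∈ 𝒜 (m - wordDegree w t) := by
  have key : ∀ u, wordDegree w u = m → cutSuffix w D u = t →
      0 < wordDegree w t ∧ wordDegree w t ≤ m ∧ m - wordDegree w t ≤ D ∧
        π (mono k (cutPrefix w D u)) ∈ 𝒜 (m - wordDegree w t) := by
    rintro u rfl rfl
    have h1 := congrArg (wordDegree w) (cutPrefix_mul_cutSuffix (w := w) D u)
    have h2 := (isCut_cut (w := w) D u).1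
    rw [wordDegree_mul] at h1
    refine ⟨by omega, by omega, by omega, ?_⟩
    rw [← h1, Nat.add_sub_cancel]
    exact S.map_mono_mem _
  have hle : ∀ P : Submodule k R, (∀ u, wordDegree w u = m → cutSuffix w D u = t →
      π (mono k (cutPrefix w D u)) ∈ P) → S.split D c t ∈ P := by
    intro P hP
    suffices H : 𝒜 m ≤ P.comap (Finsupp.lapply t ∘ₗ S.split D) from H hc
    refine S.le_of_forall_word_mem fun u hu hm ↦ ?_
    rw [Submodule.mem_comap, LinearMap.comp_apply, S.split_map_mono D hu, Finsupp.lapply_apply]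
    by_cases h : cutSuffix w D u = t
    · subst h
      simpa using hP u hm rfl
    · simp [h]
  by_cases ht : ∃ u, wordDegree w u = m ∧ cutSuffix w D u = t
  · obtain ⟨u, hu, hut⟩ := ht
    obtain ⟨h1, h2, h3, -⟩ := key u hu hut
    exact .inr ⟨h1, h2, h3, hle _ fun v hv hvt ↦ (key v hv hvt).2.2.2⟩
  · exact .inl ((Submodule.mem_bot k).1 (hle ⊥ fun v hv hvt ↦ absurd ⟨v, hv, hvt⟩ ht))

end IsProcessingBasis

end Normal

/-! ### From Gröbner bases to bases of normal words -/

section Groebner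

variable {k R : Type*} [Field k] [Ring R] [Algebra k R]

theorem map_mono_mem_of_generators {𝒜 : ℕ → Submodule k R} [GradedAlgebra 𝒜] {n : ℕ}
    {w : Fin n → ℕ} {π : FreeAlg k n →ₐ[k] R}
    (hπ : ∀ i, π (mono k (FreeMonoid.of i)) ∈ 𝒜 (w i)) (u : FreeMonoid (Fin n)) :
    π (mono k u) ∈ 𝒜 (wordDegree w u) := by
  induction u using FreeMonoid.inductionOn' with
  | one => simpa using SetLike.GradedOne.one_mem (A := 𝒜)
  | of_mul x u ih =>
    rw [mono_mul, map_mul, wordDegree_mul, wordDegree_of]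
    exact SetLike.GradedMul.mul_mem (hπ x) ih

theorem WordOrder.exists_max {n : ℕ} (o : WordOrder n) (s : Finset (FreeMonoid (Fin n)))
    (hs : s.Nonempty) : ∃ u ∈ s, ∀ v ∈ s, v ≠ u → o.lt v u := by
  induction hs using Finset.Nonempty.cons_induction with
  | singleton a => exact ⟨a, by simp⟩
  | cons a s _ _ ih =>
    obtain ⟨u, hu, hmax⟩ := ih
    rcases o.total a u with h | rfl | h
    · refine ⟨u, Finset.mem_cons_of_mem hu, fun v hv hvu ↦ ?_⟩
      rcases Finset.mem_cons.1 hv with rfl | hv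
      exacts [h, hmax v hv hvu]
    · refine ⟨a, Finset.mem_cons_self _ _, fun v hv hvu ↦ ?_⟩
      rcases Finset.mem_cons.1 hv with rfl | hv
      exacts [absurd rfl hvu, hmax v hv hvu]
    · refine ⟨a, Finset.mem_cons_self _ _, fun v hv hva ↦ ?_⟩
      rcases Finset.mem_cons.1 hv with rfl | hv
      · exact absurd rfl hva
      · by_cases hvu : v = u
        · exact hvu ▸ h
        · exact o.trans _ _ _ (hmax v hv hvu) h

theorem exists_isLeadingWord {n : ℕ} (o : WordOrder n) {f : FreeAlg k n} (hf : f ≠ 0) :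
    ∃ u, IsLeadingWord o f u := by
  obtain ⟨u, hu, hmax⟩ := o.exists_max f.coeff.support
    (Finsupp.support_nonempty_iff.2 (by simpa using hf))
  exact ⟨u, Finsupp.mem_support_iff.1 hu, fun v hv ↦ hmax v (Finsupp.mem_support_iff.2 hv)⟩

variable {n : ℕ} {π : FreeAlg k n →ₐ[k] R} {o : WordOrder n} {G : Set (FreeAlg k n)}

/-- The images in `R` of the combinations of words from `N`. -/
def supportedImage (π : FreeAlg k n →ₐ[k] R) (N : Set (FreeMonoid (Fin n))) : Submodule k R where
  carrier := {y | ∃ h, SupportedOn N h ∧ π h = y}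
  zero_mem' := ⟨0, fun u hu ↦ absurd rfl hu, map_zero π⟩
  add_mem' := by
    rintro _ _ ⟨h, hh, rfl⟩ ⟨h', hh', rfl⟩
    exact ⟨h + h', hh.add hh', map_add _ _ _⟩
  smul_mem' := by
    rintro c _ ⟨h, hh, rfl⟩
    exact ⟨c • h, hh.smul c, map_smul _ _ _⟩

/-- Reduction along the well-order: a word that is not normal is congruent to a combination of
smaller words. Only the inclusion of `G` in the ideal is needed here; the Gröbner property enters
for independence. -/
theorem exists_normal_of_isGroebnerBasis (hπ : Function.Surjective π)
    (hG : ∀ g ∈ G, g ∈ TwoSidedIdeal.ker π) (y : R) :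
    ∃ h, SupportedOn {u | IsNormalWord o G u} h ∧ π h = y := by
  have key : ∀ u, π (mono k u) ∈ supportedImage π {u | IsNormalWord o G u} := by
    intro u
    induction u using o.wf.induction with
    | _ u ih =>
    by_cases hu : IsNormalWord o G u
    · exact ⟨mono k u, supportedOn_mono hu, rfl⟩
    · unfold IsNormalWord at hu
      push Not at hu
      obtain ⟨g, hg, v, ⟨hv, hlt⟩, a, b, rfl⟩ := hu
      have hg0 : π g = 0 := (TwoSidedIdeal.mem_ker π).1 (hG g hg)
      set f : FreeAlg k n := g - g.coeff v • mono k v with hf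
      have hfc : ∀ v', f.coeff v' ≠ 0 → o.lt v' v := by
        intro v' hv'
        by_cases h : v' = v
        · subst h
          refine absurd ?_ hv'
          simp [hf]
        · refine hlt v' (fun h0 ↦ hv' ?_) h
          simp [hf, h0, Ne.symm h]
      have := linearMap_mem_of_support (h := f)
        (A := π.toLinearMap ∘ₗ LinearMap.mulLeft k (mono k a) ∘ₗ LinearMap.mulRight k (mono k b))
        (P := supportedImage π {u | IsNormalWord o G u}) fun v' hv' ↦ by
          have := ih (a * v' * b) (o.mul_lt_mul _ _ _ _ (hfc v' hv'))
          simpa [mono_mul, mul_assoc] using this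
      have h2 : (π.toLinearMap ∘ₗ LinearMap.mulLeft k (mono k a) ∘ₗ
          LinearMap.mulRight k (mono k b)) f = -(g.coeff v) • π (mono k (a * v * b)) := by
        simp [hf, hg0, mono_mul, mul_assoc]
      rw [h2] at this
      exact (Submodule.smul_mem_iff _ (neg_ne_zero.2 hv)).1 this
  obtain ⟨f, rfl⟩ := hπ y
  exact linearMap_mem_of_support (A := π.toLinearMap)
    (P := supportedImage π {u | IsNormalWord o G u}) fun u _ ↦ key u

theorem eq_zero_of_isGroebnerBasis (hG : IsGroebnerBasis o (TwoSidedIdeal.ker π) G)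
    {h : FreeAlg k n} (hh : SupportedOn {u | IsNormalWord o G u} h) (h0 : π h = 0) : h = 0 := by
  by_contra hne
  obtain ⟨u, hu⟩ := exists_isLeadingWord o hne
  obtain ⟨g, hg, v, hv, a, b, rfl⟩ := hG.2 h ((TwoSidedIdeal.mem_ker π).2 h0) u hu
  exact hh _ hu.1 g hg v hv a b rfl

theorem HasProcessing.exists_isProcessingBasis {𝒜 : ℕ → Submodule k R} [GradedAlgebra 𝒜] {r : ℕ}
    (H : HasProcessing 𝒜 r) : ∃ (n : ℕ) (w : Fin n → ℕ) (π : FreeAlg k n →ₐ[k] R)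
      (N : Set (FreeMonoid (Fin n))), IsProcessingBasis 𝒜 r w π N := by
  obtain ⟨n, w, π, o, G, hw, hsurj, hdeg, -, hG, hproc⟩ := H
  refine ⟨n, w, π, {u | IsNormalWord o G u}, hw, map_mono_mem_of_generators hdeg,
    exists_normal_of_isGroebnerBasis hsurj hG.1, fun h ↦ eq_zero_of_isGroebnerBasis hG, ?_⟩
  intro p hp q hq
  obtain ⟨q₁, q₂, hqq, hr, h, h1, h2⟩ := hproc p q hp hq
  refine ⟨q₁, q₂, hqq, hr, h, h1.1, ?_, h2.1⟩
  have := (TwoSidedIdeal.mem_ker π).1 h1.2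
  rw [map_sub, sub_eq_zero] at this
  exact this.symm

end Groebner

/-! ### Quadratic monomial algebras -/

section Monomial

/-- Equal lengths are essential: if `s` were a proper prefix of `t`, appending `v` could reverse the
comparison. -/
theorem lex_append_right {α : Type*} {r : α → α → Prop} {s t : List α} (hl : s.length = t.length)
    (h : List.Lex r s t) (v : List α) : List.Lex r (s ++ v) (t ++ v) := by
  induction h with
  | nil => simp at hl
  | cons _ ih => exact .cons (ih (by simpa using hl))
  | rel h => exact .rel h

theorem shortlex_append_right {α : Type*} {r : α → α → Prop} {s t : List α}
    (h : List.Shortlex r s t) (v : List α) : List.Shortlex r (s ++ v) (t ++ v) := by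
  rcases List.shortlex_def.1 h with h | ⟨h1, h2⟩
  · exact .of_length_lt (by simpa using h)
  · exact .of_lex (by simpa using h1) (lex_append_right h1 h2 v)

/-- The degree-lexicographic order on words. -/
def degLex (n : ℕ) : WordOrder n where
  lt a b := List.Shortlex (· < ·) a.toList b.toList
  trans a b c h h' := by
    rcases List.shortlex_def.1 h with h1 | ⟨h1, h2⟩ <;>
      rcases List.shortlex_def.1 h' with h3 | ⟨h3, h4⟩
    · exact .of_length_lt (h1.trans h3)
    · exact .of_length_lt (h3 ▸ h1)
    · exact .of_length_lt (h1 ▸ h3)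
    · refine .of_lex (h1.trans h3) ?_
      exact List.lt_trans (α := Fin n) h2 h4
  total a b := by
    by_contra! h
    exact h.2.1 ((List.Shortlex.trichotomous (r := (· < · : Fin n → Fin n → Prop))).trichotomous
      a.toList b.toList h.1 h.2.2)
  wf := InvImage.wf FreeMonoid.toList (List.Shortlex.wf wellFounded_lt)
  mul_lt_mul a b u v h := by
    simp only [FreeMonoid.toList_mul]
    exact shortlex_append_right (List.Shortlex.append_left h _) _

variable {k R : Type*} [Field k] [Ring R] [Algebra k R]

theorem isLeadingWord_mono_iff {n : ℕ} (o : WordOrder n) (u v : FreeMonoid (Fin n)) :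
    IsLeadingWord o (mono k u) v ↔ v = u := by
  simp only [IsLeadingWord, coeff_mono, Finsupp.single_apply_ne_zero]
  constructor
  · exact fun h ↦ h.1.1
  · rintro rfl
    exact ⟨⟨rfl, one_ne_zero⟩, fun v' h1 h2 ↦ absurd h1.1 h2⟩

theorem isNormalWord_mono_image_iff {n : ℕ} (o : WordOrder n) (S : Set (FreeMonoid (Fin n)))
    (u : FreeMonoid (Fin n)) :
    IsNormalWord o (mono k '' S) u ↔ ∀ s ∈ S, ∀ a b, u ≠ a * s * b := by
  simp [IsNormalWord, isLeadingWord_mono_iff]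

/-- Combinations of words containing an element of `S` already form a two-sided ideal. This makes
`S` itself a Gröbner basis for any order. -/
theorem mem_span_mono_image {n : ℕ} {S : Set (FreeMonoid (Fin n))} {f : FreeAlg k n}
    (hf : f ∈ TwoSidedIdeal.span (mono k '' S)) {u : FreeMonoid (Fin n)} (hu : f.coeff u ≠ 0) :
    ∃ s ∈ S, ∃ a b, u = a * s * b := by
  classical
  induction hf using TwoSidedIdeal.span_induction generalizing u with
  | mem x hx =>
    obtain ⟨s, hs, rfl⟩ := hx
    rw [coeff_mono, Finsupp.single_apply_ne_zero] at hu
    exact ⟨s, hs, 1, 1, by simp [hu.1]⟩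
  | zero => exact absurd rfl hu
  | add x y _ _ hx hy =>
    by_cases h : x.coeff u = 0
    · exact hy fun h' ↦ hu (by simp [h, h'])
    · exact hx h
  | neg x _ hx => exact hx fun h ↦ hu (by simp [h])
  | left_absorb a x _ hx =>
    rw [MonoidAlgebra.coeff_mul] at hu
    obtain ⟨v, -, hv⟩ := Finset.exists_ne_zero_of_sum_ne_zero hu
    obtain ⟨v', hv', h⟩ := Finset.exists_ne_zero_of_sum_ne_zero hv
    obtain ⟨s, hs, c, d, rfl⟩ := hx (Finsupp.mem_support_iff.1 hv')
    refine ⟨s, hs, v * c, d, ?_⟩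
    by_contra hne
    exact h (if_neg fun he ↦ hne (by rw [← he]; simp only [mul_assoc]))
  | right_absorb b x _ hx =>
    rw [MonoidAlgebra.coeff_mul] at hu
    obtain ⟨v, hv', hv⟩ := Finset.exists_ne_zero_of_sum_ne_zero hu
    obtain ⟨v', -, h⟩ := Finset.exists_ne_zero_of_sum_ne_zero hv
    obtain ⟨s, hs, c, d, rfl⟩ := hx (Finsupp.mem_support_iff.1 hv')
    refine ⟨s, hs, c, d * v', ?_⟩
    by_contra hne
    exact h (if_neg fun he ↦ hne (by rw [← he]; simp only [mul_assoc]))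

/-- In a product of words `p * x * q` with `x` a letter, a subword of length two lies in `p * x` or
in `x * q`. -/
theorem subword_of_length_two {n : ℕ} {s a b p q : FreeMonoid (Fin n)} {x : Fin n} (hs : s.length = 2)
    (h : p * (FreeMonoid.of x * q) = a * s * b) :
    (∃ b', p * FreeMonoid.of x = a * s * b') ∨ ∃ a', FreeMonoid.of x * q = a' * s * b := by
  -- Does the subword `s` start inside `p`? If so, having length two, it ends no later than `x`.
  by_cases hl : a.length < p.length
  · left
    rw [← mul_assoc] at h
    rcases mul_eq_mul_cases h with ⟨e, h1, -⟩ | ⟨e, h1, -⟩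
    · have h2 := congrArg FreeMonoid.length h1
      simp only [FreeMonoid.length_mul, FreeMonoid.length_of, hs] at h2
      obtain rfl : e = 1 := FreeMonoid.length_eq_zero.1 (by omega)
      exact ⟨1, by simp [h1]⟩
    · exact ⟨e, h1⟩
  · right
    rw [mul_assoc] at h
    rcases mul_eq_mul_cases h with ⟨e, -, h1⟩ | ⟨e, h1, h2⟩
    · exact ⟨e, by rw [h1, mul_assoc]⟩
    · have h3 := congrArg FreeMonoid.length h1
      simp only [FreeMonoid.length_mul] at h3
      obtain rfl : e = 1 := FreeMonoid.length_eq_zero.1 (by omega)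
      exact ⟨1, by simpa using h2.symm⟩

/-- With `q₁` the first letter `x` of `q`, either `p * x` contains a relation and the product
vanishes, or `p * q` is already normal. -/
theorem IsQuadraticMonomial.hasProcessing {𝒜 : ℕ → Submodule k R} (H : IsQuadraticMonomial 𝒜) :
    HasProcessing 𝒜 1 := by
  obtain ⟨n, π, S, hsurj, hdeg, hlen, hker⟩ := H
  have hcontains : ∀ s ∈ S, ∀ a b, mono k (a * s * b) ∈ TwoSidedIdeal.ker π := by
    intro s hs a b
    rw [mono_mul, mono_mul, hker]
    exact TwoSidedIdeal.mul_mem_right _ _ _ (TwoSidedIdeal.mul_mem_left _ _ _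
      (TwoSidedIdeal.subset_span ⟨s, hs, rfl⟩))
  refine ⟨n, fun _ ↦ 1, π, degLex n, mono k '' S, fun _ ↦ one_pos, hsurj, hdeg, ?_, ⟨?_, ?_⟩, ?_⟩
  · refine Set.Finite.image _ ((finite_setOf_wordDegree_eq (w := fun _ : Fin n ↦ 1)
      (fun _ ↦ one_pos) 2).subset fun u hu ↦ ?_)
    show ((u.toList.map fun _ ↦ 1).sum = 2)
    have : u.toList.length = 2 := hlen u hu
    simpa using this
  · rintro _ ⟨s, hs, rfl⟩
    simpa using hcontains s hs 1 1
  · intro f hf u hu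
    rw [hker] at hf
    obtain ⟨s, hs, a, b, rfl⟩ := mem_span_mono_image hf hu.1
    exact ⟨mono k s, ⟨s, hs, rfl⟩, s, (isLeadingWord_mono_iff _ _ _).2 rfl, a, b, rfl⟩
  · intro p q hp hq
    induction q using FreeMonoid.inductionOn' with
    | one =>
      refine ⟨1, 1, by simp, by simp, mono k p, ⟨?_, ?_⟩, ⟨?_, ?_⟩⟩
      · exact supportedOn_mono (N := {u | IsNormalWord (degLex n) (mono k '' S) u}) hp
      · simp
      · rw [mono_one, mul_one]
        exact supportedOn_mono (N := {u | IsNormalWord (degLex n) (mono k '' S) u}) hp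
      · simp
    | of_mul x q _ =>
      rw [isNormalWord_mono_image_iff] at hq
      by_cases hpx : IsNormalWord (degLex n) (mono k '' S) (p * FreeMonoid.of x)
      · refine ⟨FreeMonoid.of x, q, rfl, by simp, mono k (p * FreeMonoid.of x), ⟨?_, ?_⟩, ⟨?_, ?_⟩⟩
        · exact supportedOn_mono (N := {u | IsNormalWord (degLex n) (mono k '' S) u}) hpx
        · simp
        · rw [← mono_mul]
          refine supportedOn_mono (N := {u | IsNormalWord (degLex n) (mono k '' S) u}) ?_
          refine (isNormalWord_mono_image_iff _ _ _).2 fun s hs a b h ↦ ?_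
          rw [mul_assoc] at h
          rcases subword_of_length_two (hlen s hs) h with ⟨b', h'⟩ | ⟨a', h'⟩
          · exact (isNormalWord_mono_image_iff _ _ _).1 hpx s hs _ _ h'
          · exact hq s hs _ _ h'
        · simp [mono_mul, mul_assoc]
      · rw [isNormalWord_mono_image_iff] at hpx
        push Not at hpx
        obtain ⟨s, hS, a, b, hs⟩ := hpx
        refine ⟨FreeMonoid.of x, q, rfl, by simp, 0, ⟨?_, ?_⟩, ⟨?_, ?_⟩⟩
        · exact fun u hu ↦ absurd rfl hu
        · rw [sub_zero, hs]
          exact hcontains s hS a b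
        · rw [zero_mul]
          exact fun u hu ↦ absurd rfl hu
        · rw [zero_mul, sub_zero, ← mul_assoc, hs, mul_assoc _ b]
          exact hcontains s hS a _

end Monomial

/-! ### Generators and relations of graded right ideals -/

section Ideals

variable {k R : Type*} [Field k] [Ring R] [Algebra k R] {𝒜 : ℕ → Submodule k R}

theorem nontrivial_quotient_submoduleOf_iff {M : Type*} [AddCommGroup M] [Module k M]
    (A B : Submodule k M) : Nontrivial (↥B ⧸ A.submoduleOf B) ↔ ¬ B ≤ A := by
  rw [Submodule.Quotient.nontrivial_iff, Submodule.submoduleOf, Ne,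
    Submodule.comap_subtype_eq_top]

theorem iSup_degree_le_iff {P : ℕ → Prop} {d : ℕ} :
    (⨆ (j : ℕ) (_ : P j), (j : ℕ∞)) ≤ d ↔ ∀ j, d < j → ¬ P j := by
  simp only [iSup_le_iff, Nat.cast_le]
  exact forall_congr' fun j ↦ ⟨fun h hj hP ↦ (h hP).not_gt hj, fun h hP ↦ not_lt.1 fun hj ↦ h hj hP⟩

theorem m0_le_iff {L : Submodule Rᵐᵒᵖ R} {d : ℕ} :
    m0 𝒜 L ≤ d ↔ ∀ j, d < j → bar0 𝒜 L j ≤ (bar1 𝒜 L j).map (barD1 k R) := by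
  simp only [m0, iSup_degree_le_iff, nontrivial_quotient_submoduleOf_iff, not_not]

theorem m1_le_iff {L : Submodule Rᵐᵒᵖ R} {d : ℕ} :
    m1 𝒜 L ≤ d ↔ ∀ j, d < j →
      bar1 𝒜 L j ⊓ LinearMap.ker (barD1 k R) ≤ (bar2 𝒜 L j).map (barD2 k R) := by
  simp only [m1, iSup_degree_le_iff, nontrivial_quotient_submoduleOf_iff, not_not]

theorem map_barD1_le_iff {L : Submodule Rᵐᵒᵖ R} {j : ℕ} {P : Submodule k R} :
    (bar1 𝒜 L j).map (barD1 k R) ≤ P ↔ ∀ p q, 0 < q → p + q = j →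
      ∀ m ∈ bar0 𝒜 L p, ∀ a ∈ 𝒜 q, m * a ∈ P := by
  rw [Submodule.map_le_iff_le_comap, bar1, Submodule.span_le]
  constructor
  · intro h p q hq hj m hm a ha
    exact h ⟨p, q, hq, hj, m, hm, a, ha, rfl⟩
  · rintro h _ ⟨p, q, hq, hj, m, hm, a, ha, rfl⟩
    exact h p q hq hj m hm a ha

theorem mul_mem_map_barD1 {L : Submodule Rᵐᵒᵖ R} {j p q : ℕ} (hq : 0 < q) (hj : p + q = j) {m a : R}
    (hm : m ∈ bar0 𝒜 L p) (ha : a ∈ 𝒜 q) : m * a ∈ (bar1 𝒜 L j).map (barD1 k R) :=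
  map_barD1_le_iff.1 le_rfl p q hq hj m hm a ha

/-- If `L` is generated in degrees at most `d`, then so are its homogeneous components. -/
theorem bar0_le_span_mul [GradedAlgebra 𝒜] {L : Submodule Rᵐᵒᵖ R} {d : ℕ} (hL : m0 𝒜 L ≤ d)
    (j : ℕ) : bar0 𝒜 L j ≤ Submodule.span k {z | ∃ p q, p ≤ d ∧ p + q = j ∧
      ∃ m ∈ bar0 𝒜 L p, ∃ a ∈ 𝒜 q, z = m * a} := by
  induction j using Nat.strong_induction_on with
  | _ j ih =>
  by_cases hj : j ≤ d
  · intro y hy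
    exact Submodule.subset_span ⟨j, 0, hj, rfl, y, hy, 1, SetLike.GradedOne.one_mem,
      (mul_one y).symm⟩
  · refine (m0_le_iff.1 hL j (by omega)).trans (map_barD1_le_iff.2 fun p q hq hpq m hm a ha ↦ ?_)
    have h1 := ih p (by omega) hm
    revert h1
    suffices h : _ ≤ (Submodule.span k _).comap (LinearMap.mulRight k a) from fun h1 ↦ h h1
    rw [Submodule.span_le]
    rintro _ ⟨p', q', hp', hpq', m', hm', a', ha', rfl⟩
    exact Submodule.subset_span ⟨p', q' + q, hp', by omega, m', hm', a' * a,
      SetLike.GradedMul.mul_mem ha' ha, by simp [mul_assoc]⟩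

/-- The map `A` is only `k`-linear, so the induction carries an arbitrary right factor `a`, which
absorbs the action of `Rᵐᵒᵖ`. -/
theorem map_mem_of_mem_span {M : Type*} [AddCommGroup M] [Module k M] {T : Set R}
    {A : R →ₗ[k] M} {P : Submodule k M} (H : ∀ t ∈ T, ∀ a, A (t * a) ∈ P) {z : R}
    (hz : z ∈ Submodule.span Rᵐᵒᵖ T) : A z ∈ P := by
  suffices h : ∀ a, A (z * a) ∈ P by simpa using h 1
  induction hz using Submodule.span_induction with
  | mem x hx => exact H x hx
  | zero => simp
  | add x y _ _ hx hy => intro a; rw [add_mul, map_add]; exact P.add_mem (hx a) (hy a)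
  | smul c x _ hx => intro a; rw [← MulOpposite.op_unop c, op_smul_eq_mul, mul_assoc]; exact hx _

theorem proj_mul_of_mem [GradedAlgebra 𝒜] {p : ℕ} {t : R} (ht : t ∈ 𝒜 p) (a : R) (j : ℕ) :
    GradedAlgebra.proj 𝒜 j (t * a) = if p ≤ j then t * GradedAlgebra.proj 𝒜 (j - p) a else 0 := by
  simp only [GradedAlgebra.proj_apply]
  exact DirectSum.coe_decompose_mul_of_left_mem 𝒜 j ht

theorem proj_mem [GradedAlgebra 𝒜] (a : R) (j : ℕ) : GradedAlgebra.proj 𝒜 j a ∈ 𝒜 j := by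
  rw [GradedAlgebra.proj_apply]; exact SetLike.coe_mem _

theorem isHomogeneous_span [GradedAlgebra 𝒜] {T : Set R} (hT : ∀ t ∈ T, ∃ p, t ∈ 𝒜 p) :
    (Submodule.span Rᵐᵒᵖ T).IsHomogeneous 𝒜 := by
  intro j z hz
  refine map_mem_of_mem_span (A := GradedAlgebra.proj 𝒜 j)
    (P := (Submodule.span Rᵐᵒᵖ T).restrictScalars k) (fun t ht a ↦ ?_) hz
  obtain ⟨p, hp⟩ := hT t ht
  rw [proj_mul_of_mem hp]
  split_ifs
  · exact Submodule.smul_mem _ (MulOpposite.op _) (Submodule.subset_span ht)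
  · exact zero_mem _

theorem m0_span_le [GradedAlgebra 𝒜] {T : Set R} {d : ℕ} (hT : ∀ t ∈ T, ∃ p ≤ d, t ∈ 𝒜 p) :
    m0 𝒜 (Submodule.span Rᵐᵒᵖ T) ≤ d := by
  refine m0_le_iff.2 fun j hj y hy ↦ ?_
  have hy' : GradedAlgebra.proj 𝒜 j y = y := by
    rw [GradedAlgebra.proj_apply, DirectSum.decompose_of_mem_same _ hy.2]
  rw [← hy']
  refine map_mem_of_mem_span (fun t ht a ↦ ?_) hy.1
  obtain ⟨p, hpd, hp⟩ := hT t ht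
  rw [proj_mul_of_mem hp, if_pos (by omega)]
  exact mul_mem_map_barD1 (by omega) (by omega) ⟨Submodule.subset_span ht, hp⟩ (proj_mem _ _)

theorem eq_span_of_m0_le [GradedAlgebra 𝒜] {L : Submodule Rᵐᵒᵖ R} (hL : L.IsHomogeneous 𝒜) {d : ℕ}
    (hd : m0 𝒜 L ≤ d) : L = Submodule.span Rᵐᵒᵖ {y | ∃ p ≤ d, y ∈ bar0 𝒜 L p} := by
  classical
  refine le_antisymm (fun z hz ↦ ?_) (Submodule.span_le.2 ?_)
  · rw [← DirectSum.sum_support_decompose 𝒜 z]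
    refine Submodule.sum_mem _ fun j _ ↦ ?_
    have h1 := bar0_le_span_mul hd j ⟨hL j hz, SetLike.coe_mem _⟩
    suffices h : Submodule.span k _ ≤ Submodule.restrictScalars k (Submodule.span Rᵐᵒᵖ
      {y | ∃ p ≤ d, y ∈ bar0 𝒜 L p}) from h h1
    rw [Submodule.span_le]
    rintro _ ⟨p, q, hp, -, m, hm, a, -, rfl⟩
    exact Submodule.smul_mem _ (MulOpposite.op a) (Submodule.subset_span ⟨p, hp, hm⟩)
  · rintro y ⟨p, -, hy⟩
    exact hy.1

theorem isHomogeneous_colon [GradedAlgebra 𝒜] {J : Submodule Rᵐᵒᵖ R} (hJ : J.IsHomogeneous 𝒜)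
    {e : ℕ} {x : R} (hx : x ∈ 𝒜 e) : (colon x J).IsHomogeneous 𝒜 := by
  intro i a ha
  show x * _ ∈ J
  rw [← DirectSum.coe_decompose_mul_add_of_left_mem 𝒜 hx]
  exact hJ _ ha

theorem tmul_sub_mem_map_barD2 {L : Submodule Rᵐᵒᵖ R} {p q s j : ℕ} (hq : 0 < q) (hs : 0 < s)
    (hj : p + q + s = j) {m a b : R} (hm : m ∈ bar0 𝒜 L p) (ha : a ∈ 𝒜 q) (hb : b ∈ 𝒜 s) :
    (m * a) ⊗ₜ[k] b - m ⊗ₜ[k] (a * b) ∈ (bar2 𝒜 L j).map (barD2 k R) :=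
  ⟨_, Submodule.subset_span ⟨p, q, s, hq, hs, hj, m, hm, a, ha, b, hb, rfl⟩, by simp [barD2]⟩

/-! ### Degree bounds for colon ideals and relations -/

namespace IsProcessingBasis

variable [GradedAlgebra 𝒜] {r : ℕ} {n : ℕ} {w : Fin n → ℕ}
  {π : FreeAlg k n →ₐ[k] R} {N : Set (FreeMonoid (Fin n))}
  (S : IsProcessingBasis 𝒜 r w π N)

include S

theorem m0_colon_le {T : Set R} {e : ℕ} (hT : ∀ t ∈ T, ∃ p ≤ e, t ∈ 𝒜 p) {x : R}
    (hx : x ∈ 𝒜 e) : m0 𝒜 (colon x (Submodule.span Rᵐᵒᵖ T)) ≤ r := by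
  refine m0_le_iff.2 fun j hj a ha ↦ ?_
  have hmem : ∀ t, S.split r a t ∈ colon x (Submodule.span Rᵐᵒᵖ T) := by
    intro t
    show x * S.split r a t ∈ Submodule.span Rᵐᵒᵖ T
    -- Cutting `x a` at `e + r` cuts `a` at `r`, and `e + r` is also large enough for every
    -- generator in `T`.
    have h1 := S.split_mul_apply (D := e + r) le_rfl hx a t
    rw [Nat.add_sub_cancel_left] at h1
    rw [← h1]
    refine map_mem_of_mem_span (A := Finsupp.lapply t ∘ₗ S.split (e + r))
      (P := (Submodule.span Rᵐᵒᵖ T).restrictScalars k) (fun y hy c ↦ ?_) ha.1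
    obtain ⟨p, hpe, hp⟩ := hT y hy
    rw [LinearMap.comp_apply, Finsupp.lapply_apply, S.split_mul_apply (by omega) hp]
    exact Submodule.smul_mem _ (MulOpposite.op _) (Submodule.subset_span hy)
  rw [← S.sum_split r a]
  refine Submodule.sum_mem _ fun t _ ↦ ?_
  rcases S.split_apply_mem hj ha.2 t with h | ⟨h1, h2, -, h3⟩
  · simp only [h, zero_mul, zero_mem]
  · exact mul_mem_map_barD1 h1 (by omega) ⟨hmem t, h3⟩ (S.map_mono_mem t)

/-- The splitting of an element of `R`, as an element of `R ⊗ R`. -/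
def splitTensor (D : ℕ) : R →ₗ[k] R ⊗[k] R :=
  (Finsupp.lsum k fun t ↦ (TensorProduct.mk k R R).flip (π (mono k t))) ∘ₗ S.split D

theorem splitTensor_mul_map_mono {p D : ℕ} (hD : p + r ≤ D) {g : R} (hg : g ∈ 𝒜 p)
    {u : FreeMonoid (Fin n)} (hu : u ∈ N) : S.splitTensor D (g * π (mono k u)) =
      (g * π (mono k (cutPrefix w (D - p) u))) ⊗ₜ π (mono k (cutSuffix w (D - p) u)) := by
  rw [splitTensor, LinearMap.comp_apply, S.split_mul hD hg, S.split_map_mono _ hu,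
    Finsupp.mapRange.linearMap_apply, Finsupp.mapRange_single, Finsupp.lsum_single]
  rfl

/-- For a normal word `a = b t` cut at `D - p`, the difference of `g ⊗ b t` and `g b ⊗ t` is, up to
sign, the boundary of `g ⊗ b ⊗ t`. The bound `D < p + q` ensures that `t` has positive degree. -/
theorem tmul_sub_splitTensor_mem {L : Submodule Rᵐᵒᵖ R} {p q D : ℕ} (hD : p + r ≤ D)
    (hpq : D < p + q) {g a : R} (hg : g ∈ bar0 𝒜 L p) (ha : a ∈ 𝒜 q) :
    g ⊗ₜ[k] a - S.splitTensor D (g * a) ∈ (bar2 𝒜 L (p + q)).map (barD2 k R) := by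
  suffices h : 𝒜 q ≤ ((bar2 𝒜 L (p + q)).map (barD2 k R)).comap
      (TensorProduct.mk k R R g - S.splitTensor D ∘ₗ LinearMap.mulLeft k g) from h ha
  refine S.le_of_forall_word_mem fun u hu hdeg ↦ ?_
  simp only [Submodule.mem_comap, LinearMap.sub_apply, LinearMap.comp_apply,
    LinearMap.mulLeft_apply, TensorProduct.mk_apply]
  rw [S.splitTensor_mul_map_mono hD hg.2 hu]
  have h1 := cutPrefix_mul_cutSuffix (w := w) (D - p) u
  have h2 := (isCut_cut (w := w) (D - p) u).1
  set b := cutPrefix w (D - p) u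
  set t := cutSuffix w (D - p) u
  clear_value b t
  subst h1
  rw [wordDegree_mul] at hdeg
  -- The reduced bar complex has no chain with `b = 1`, but then the two tensors coincide.
  by_cases hb : wordDegree w b = 0
  · rw [eq_one_of_wordDegree_eq_zero S.pos hb]
    simp
  · rw [← neg_sub, mono_mul, map_mul]
    exact neg_mem (tmul_sub_mem_map_barD2 (by omega) (by omega) (by omega) hg
      (S.map_mono_mem b) (S.map_mono_mem t))

/-- The relations of a right ideal that is generated in degrees at most `d` are generated in
degrees at most `d + r`. -/
theorem m1_le {L : Submodule Rᵐᵒᵖ R} {d : ℕ} (hL : m0 𝒜 L ≤ d) :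
    m1 𝒜 L ≤ ((d + r : ℕ) : ℕ∞) := by
  refine m1_le_iff.2 fun j hj z hz ↦ ?_
  -- Every chain `z` is homologous to the splitting of its boundary `barD1 z`, which is zero when
  -- `z` is a cycle.
  suffices h : bar1 𝒜 L j ≤ ((bar2 𝒜 L j).map (barD2 k R)).comap
      (LinearMap.id - S.splitTensor (d + r) ∘ₗ barD1 k R) by
    have := h hz.1
    rwa [Submodule.mem_comap, LinearMap.sub_apply, LinearMap.comp_apply,
      LinearMap.mem_ker.1 hz.2, map_zero, sub_zero] at this
  rw [bar1, Submodule.span_le]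
  rintro _ ⟨p, q, hq, rfl, m, hm, a, ha, rfl⟩
  show m ⊗ₜ[k] a - S.splitTensor (d + r) (m * a) ∈ (bar2 𝒜 L (p + q)).map (barD2 k R)
  by_cases hp : p ≤ d
  · exact S.tmul_sub_splitTensor_mem (by omega) hj hm ha
  -- When `deg m > d`, write `m` as a sum of `g c` with `deg g ≤ d` and pass from `g c ⊗ a` to `g ⊗
  -- c a` by a boundary.
  suffices h : Submodule.span k {z | ∃ p' q', p' ≤ d ∧ p' + q' = p ∧
      ∃ m ∈ bar0 𝒜 L p', ∃ a ∈ 𝒜 q', z = m * a} ≤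
      ((bar2 𝒜 L (p + q)).map (barD2 k R)).comap ((TensorProduct.mk k R R).flip a -
        S.splitTensor (d + r) ∘ₗ LinearMap.mulRight k a) from h (bar0_le_span_mul hL p hm)
  rw [Submodule.span_le]
  rintro _ ⟨p', q', hp', rfl, g, hg, c, hc, rfl⟩
  show (g * c) ⊗ₜ[k] a - S.splitTensor (d + r) (g * c * a) ∈
    (bar2 𝒜 L (p' + q' + q)).map (barD2 k R)
  have h1 := S.tmul_sub_splitTensor_mem (D := d + r) (by omega) (by omega) hg
    (SetLike.GradedMul.mul_mem hc ha)
  rw [← add_assoc] at h1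
  rw [mul_assoc g, ← sub_add_sub_cancel _ (g ⊗ₜ[k] (c * a))]
  exact add_mem (tmul_sub_mem_map_barD2 (by omega) hq rfl hg hc ha) h1

end IsProcessingBasis

end Ideals

/-! ### Coherent families -/

section Coherent

variable {k R : Type*} [Field k] [Ring R] [Algebra k R] {𝒜 : ℕ → Submodule k R}
  [GradedAlgebra 𝒜]

theorem exists_mem_bar0_notMem {I : Submodule Rᵐᵒᵖ R} (hI : I.IsHomogeneous 𝒜) (hne : I ≠ ⊥)
    {e : ℕ} (he : m0 𝒜 I = e) : ∃ x ∈ bar0 𝒜 I e, x ∉ (bar1 𝒜 I e).map (barD1 k R) := by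
  by_contra! h
  have h1 := m0_le_iff.1 he.le
  -- The value `e = 0` might come from the empty supremum. In that case `I` is spanned by its degree
  -- `0` part, where decomposable elements vanish, so `I` would be zero.
  rcases Nat.eq_zero_or_pos e with rfl | hpos
  · refine hne ((eq_span_of_m0_le hI he.le).trans (Submodule.span_eq_bot.2 ?_))
    rintro y ⟨p, hp, hy⟩
    obtain rfl : p = 0 := by omega
    have : (bar1 𝒜 I 0).map (barD1 k R) ≤ ⊥ := map_barD1_le_iff.2 fun p q hq hpq ↦ by omega
    exact (Submodule.mem_bot k).1 (this (h y hy))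
  · have : m0 𝒜 I ≤ ((e - 1 : ℕ) : ℕ∞) := m0_le_iff.2 fun j hj ↦ by
      rcases (show e = j ∨ e < j by omega) with rfl | h2
      exacts [h, h1 j h2]
    rw [he, Nat.cast_le] at this
    omega

/-- Removing one minimal generator of the largest degree. -/
theorem exists_remove_generator (hconn : IsConnected 𝒜) {I : Submodule Rᵐᵒᵖ R}
    (hI : I.IsHomogeneous 𝒜) (hne : I ≠ ⊥) {e : ℕ} (he : m0 𝒜 I = e) :
    ∃ (T : Set R) (x : R), (∀ t ∈ T, ∃ p ≤ e, t ∈ 𝒜 p) ∧ x ∈ 𝒜 e ∧ x ∈ I ∧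
      x ∉ Submodule.span Rᵐᵒᵖ T ∧ I = Submodule.span Rᵐᵒᵖ T ⊔ Submodule.span Rᵐᵒᵖ {x} := by
  obtain ⟨x, hx, hxM⟩ := exists_mem_bar0_notMem hI hne he
  obtain ⟨f, hfx, hf⟩ := Submodule.exists_le_ker_of_notMem hxM
  have hker : ∀ y ∈ (bar1 𝒜 I e).map (barD1 k R), f y = 0 := fun y hy ↦ hf hy
  -- The functional `f` kills the decomposable elements of degree `e` but not `x`. Its kernel in
  -- degree `e`, with everything of lower degree, generates a complement to `x`.
  set T : Set R := {y | (∃ p < e, y ∈ bar0 𝒜 I p) ∨ y ∈ bar0 𝒜 I e ∧ f y = 0} with hT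
  have hTI : Submodule.span Rᵐᵒᵖ T ≤ I := by
    rw [Submodule.span_le]
    rintro y (⟨p, -, hy⟩ | ⟨hy, -⟩)
    exacts [hy.1, hy.1]
  refine ⟨T, x, ?_, hx.2, hx.1, fun hxT ↦ hfx ?_, le_antisymm ?_ ?_⟩
  · rintro t (⟨p, hp, ht⟩ | ⟨ht, -⟩)
    exacts [⟨p, hp.le, ht.2⟩, ⟨e, le_rfl, ht.2⟩]
  · have := map_mem_of_mem_span (A := f ∘ₗ GradedAlgebra.proj 𝒜 e) (P := ⊥) ?_ hxT
    · rwa [LinearMap.comp_apply, GradedAlgebra.proj_apply,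
        DirectSum.decompose_of_mem_same _ hx.2, Submodule.mem_bot] at this
    rintro t (⟨p, hp, ht⟩ | ⟨ht, hft⟩) a <;>
      rw [LinearMap.comp_apply, Submodule.mem_bot, proj_mul_of_mem ht.2]
    · rw [if_pos hp.le]
      exact hker _ (mul_mem_map_barD1 (by omega) (by omega) ht (proj_mem _ _))
    · rw [if_pos le_rfl, Nat.sub_self]
      -- Connectedness enters here: the degree `0` component of `a` is a scalar, so it preserves the
      -- kernel of `f`.
      obtain ⟨c, hc⟩ := hconn.2 _ (proj_mem (𝒜 := 𝒜) a 0)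
      rw [← hc, ← Algebra.commutes, ← Algebra.smul_def, map_smul, hft, smul_zero]
  · conv_lhs => rw [eq_span_of_m0_le hI he.le]
    rw [Submodule.span_le]
    rintro y ⟨p, hp, hy⟩
    rcases hp.lt_or_eq with hp | rfl
    · exact Submodule.mem_sup_left (Submodule.subset_span (.inl ⟨p, hp, hy⟩))
    · rw [← sub_add_cancel y ((f y / f x) • x)]
      refine Submodule.add_mem_sup (Submodule.subset_span (.inr ⟨?_, ?_⟩)) ?_
      · exact sub_mem hy (Submodule.smul_mem _ _ hx)
      · simp [hfx]
      · exact Submodule.smul_of_tower_mem _ _ (Submodule.mem_span_singleton_self x)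
  · exact sup_le hTI ((Submodule.span_singleton_le_iff_mem _ _).2 hx.1)

/-! ### Coherence from a processing basis -/

namespace IsProcessingBasis

variable {r : ℕ} {n : ℕ} {w : Fin n → ℕ} {π : FreeAlg k n →ₐ[k] R} {N : Set (FreeMonoid (Fin n))}
  (S : IsProcessingBasis 𝒜 r w π N)

include S

theorem finite_component (p : ℕ) : Module.Finite k (𝒜 p) := by
  have hfin : ((fun u ↦ π (mono k u)) '' {u | wordDegree w u = p}).Finite :=
    (finite_setOf_wordDegree_eq S.pos p).image _
  have := FiniteDimensional.span_of_finite k hfin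
  have hle : 𝒜 p ≤ Submodule.span k ((fun u ↦ π (mono k u)) '' {u | wordDegree w u = p}) :=
    S.le_of_forall_word_mem fun u _ hu ↦ Submodule.subset_span ⟨u, hu, rfl⟩
  exact Submodule.finiteDimensional_of_le hle

theorem fg_of_m0_le {L : Submodule Rᵐᵒᵖ R} (hL : L.IsHomogeneous 𝒜) {d : ℕ}
    (hd : m0 𝒜 L ≤ d) : L.FG := by
  have hfg : ∀ p, (bar0 𝒜 L p).FG := by
    intro p
    have := S.finite_component p
    have : Module.Finite k (bar0 𝒜 L p) := Submodule.finiteDimensional_of_le inf_le_right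
    exact Module.Finite.iff_fg.1 this
  choose s hs using hfg
  classical
  refine ⟨(Finset.range (d + 1)).biUnion s, le_antisymm ?_ ?_⟩
  · rw [Submodule.span_le]
    intro y hy
    simp only [Finset.coe_biUnion, Set.mem_iUnion] at hy
    obtain ⟨p, -, hp⟩ := hy
    have : y ∈ bar0 𝒜 L p := hs p ▸ Submodule.subset_span hp
    exact this.1
  · conv_lhs => rw [eq_span_of_m0_le hL hd]
    rw [Submodule.span_le]
    rintro y ⟨p, hp, hy⟩
    rw [← hs p] at hy
    suffices h : Submodule.span k (s p : Set R) ≤ Submodule.restrictScalars k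
      (Submodule.span Rᵐᵒᵖ ((Finset.range (d + 1)).biUnion s : Set R)) from h hy
    rw [Submodule.span_le]
    intro z hz
    refine Submodule.subset_span ?_
    simp only [Finset.coe_biUnion, Set.mem_iUnion]
    exact ⟨p, by simpa using Nat.lt_succ_of_le hp, hz⟩

theorem universallyDCoherent (hconn : IsConnected 𝒜) {d : ℕ} (hrd : r ≤ d)
    (hirr : m0 𝒜 (irrelevant 𝒜) ≤ d) : UniversallyDCoherent 𝒜 d where
  homogeneous I hI := hI.1
  fg I hI := S.fg_of_m0_le hI.1 hI.2
  bot_mem := by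
    rw [← Submodule.span_empty]
    exact ⟨isHomogeneous_span (k := k) (by simp), m0_span_le (by simp)⟩
  irrelevant_mem := ⟨isHomogeneous_span fun t ⟨i, _, ht⟩ ↦ ⟨i, ht⟩, hirr⟩
  step := by
    rintro I ⟨hI, hd⟩ hne
    obtain ⟨e, he⟩ := ENat.ne_top_iff_exists.1 (ne_top_of_le_ne_top (ENat.natCast_ne_top d) hd)
    obtain ⟨T, x, hT, hxe, hxI, hxT, hsup⟩ := exists_remove_generator hconn hI hne he.symm
    have hhom := isHomogeneous_span fun t ht ↦ (hT t ht).imp fun _ h ↦ h.2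
    have hm : m0 𝒜 (Submodule.span Rᵐᵒᵖ T) ≤ m0 𝒜 I := (m0_span_le hT).trans he.le
    exact ⟨_, ⟨hhom, hm.trans hd⟩, fun h ↦ hxT (h ▸ hxI), x, hxI, ⟨e, hxe⟩, hsup, hm,
      isHomogeneous_colon hhom hxe, (S.m0_colon_le hT hxe).trans (Nat.cast_le.2 hrd)⟩

/-- The letters generate `R_{≥1}`; the sum of their degrees is a crude substitute for the maximum,
enough for a bound valid for large `d`. -/
theorem m0_irrelevant_le : m0 𝒜 (irrelevant 𝒜) ≤ ((∑ i, w i : ℕ) : ℕ∞) := by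
  have h : irrelevant 𝒜 =
      Submodule.span Rᵐᵒᵖ (Set.range fun i ↦ π (mono k (FreeMonoid.of i))) := by
    refine le_antisymm (Submodule.span_le.2 ?_) (Submodule.span_mono ?_)
    · rintro y ⟨j, hj, hy⟩
      suffices H : 𝒜 j ≤ (Submodule.span Rᵐᵒᵖ
        (Set.range fun i ↦ π (mono k (FreeMonoid.of i)))).restrictScalars k from H hy
      refine S.le_of_forall_word_mem fun u _ hu ↦ ?_
      induction u using FreeMonoid.inductionOn' with
      | one => simp at hu; omega
      | of_mul x u _ =>
        rw [mono_mul, map_mul]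
        exact Submodule.smul_mem _ (MulOpposite.op _) (Submodule.subset_span ⟨x, rfl⟩)
    · rintro _ ⟨i, rfl⟩
      exact ⟨w i, S.pos i, by simpa using S.map_mono_mem (FreeMonoid.of i)⟩
  rw [h]
  refine m0_span_le ?_
  rintro _ ⟨i, rfl⟩
  exact ⟨w i, Finset.single_le_sum (fun _ _ ↦ Nat.zero_le _) (Finset.mem_univ i),
    by simpa using S.map_mono_mem (FreeMonoid.of i)⟩

theorem syzygyBound_le (d : ℕ) : syzygyBound 𝒜 d ≤ ((d + r : ℕ) : ℕ∞) :=
  iSup_le fun _ ↦ iSup_le fun _ ↦ iSup_le fun h ↦ S.m1_le h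

end IsProcessingBasis

theorem GeneratedInDegreeOne.m0_irrelevant_le (H : GeneratedInDegreeOne 𝒜) :
    m0 𝒜 (irrelevant 𝒜) ≤ ((1 : ℕ) : ℕ∞) := by
  set P : Submodule Rᵐᵒᵖ R := Submodule.span Rᵐᵒᵖ (𝒜 1 : Set R) with hP
  have hmul : ∀ p ∈ P, ∀ a, p * a ∈ P := fun p hp a ↦ P.smul_mem (MulOpposite.op a) hp
  -- The sum of the scalars and the right ideal generated by degree one is a subalgebra, hence all
  -- of `R`.
  have hdecomp : ∀ y : R, ∃ c : k, ∃ p ∈ P, y = algebraMap k R c + p := by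
    intro y
    have hy : y ∈ Algebra.adjoin k (𝒜 1 : Set R) := by rw [H]; trivial
    induction hy using Algebra.adjoin_induction with
    | mem x hx => exact ⟨0, x, Submodule.subset_span hx, by simp⟩
    | algebraMap c => exact ⟨c, 0, zero_mem _, by simp⟩
    | add x y _ _ hx hy =>
      obtain ⟨c, p, hp, rfl⟩ := hx
      obtain ⟨c', p', hp', rfl⟩ := hy
      exact ⟨c + c', p + p', add_mem hp hp', by rw [map_add]; abel⟩
    | mul x y _ _ hx hy =>
      obtain ⟨c, p, hp, rfl⟩ := hx
      obtain ⟨c', p', hp', rfl⟩ := hy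
      refine ⟨c * c', p' * algebraMap k R c + p * (algebraMap k R c' + p'),
        add_mem (hmul _ hp' _) (hmul _ hp _), ?_⟩
      rw [map_mul, ← Algebra.commutes c p', add_mul, mul_add, add_assoc]
  have h : irrelevant 𝒜 = P := by
    refine le_antisymm (Submodule.span_le.2 ?_)
      (Submodule.span_mono fun y hy ↦ ⟨1, one_pos, hy⟩)
    rintro y ⟨i, hi, hy⟩
    obtain ⟨c, p, hp, rfl⟩ := hdecomp y
    have h1 := DirectSum.decompose_of_mem_same 𝒜 hy
    rw [DirectSum.decompose_add, DirectSum.add_apply, Submodule.coe_add,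
      DirectSum.decompose_of_mem_ne 𝒜 (SetLike.algebraMap_mem_graded 𝒜 c) hi.ne, zero_add] at h1
    rw [← h1]
    exact isHomogeneous_span (fun t ht ↦ ⟨1, ht⟩) i hp
  rw [h]
  exact m0_span_le fun t ht ↦ ⟨1, le_rfl, ht⟩

omit [GradedAlgebra 𝒜] in
theorem IsQuadraticMonomial.generatedInDegreeOne (H : IsQuadraticMonomial 𝒜) :
    GeneratedInDegreeOne 𝒜 := by
  obtain ⟨n, π, S, hsurj, hdeg, -, -⟩ := H
  refine Algebra.eq_top_iff.2 fun y ↦ ?_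
  obtain ⟨f, rfl⟩ := hsurj y
  refine linearMap_mem_of_support (A := π.toLinearMap)
    (P := Subalgebra.toSubmodule (Algebra.adjoin k (𝒜 1 : Set R))) fun u hu ↦ ?_
  clear hu
  show π (mono k u) ∈ Algebra.adjoin k (𝒜 1 : Set R)
  induction u using FreeMonoid.inductionOn' with
  | one => simp
  | of_mul x u ih =>
    rw [mono_mul, map_mul]
    exact mul_mem (Algebra.subset_adjoin (hdeg x)) ih

theorem HasProcessing.universallyKoszul (hconn : IsConnected 𝒜) (H : HasProcessing 𝒜 1)
    (H' : GeneratedInDegreeOne 𝒜) : UniversallyKoszul 𝒜 := by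
  obtain ⟨n, w, π, N, S⟩ := H.exists_isProcessingBasis
  exact S.universallyDCoherent hconn le_rfl H'.m0_irrelevant_le

end Coherent

end GradedRight

end

theorem mainTheorem12 {k R : Type*} [Field k] [Ring R] [Algebra k R]
    (𝒜 : ℕ → Submodule k R) [GradedAlgebra 𝒜] (hconn : GradedRight.IsConnected 𝒜) :
    (∀ r : ℕ, GradedRight.HasProcessing 𝒜 r →
      (∀ d : ℕ, GradedRight.syzygyBound 𝒜 d ≤ ((d + 2 * r : ℕ) : ℕ∞)) ∧
      (∀ᶠ d : ℕ in Filter.atTop, GradedRight.syzygyBound 𝒜 d ≤ ((2 * d : ℕ) : ℕ∞)) ∧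
      GradedRight.UniversallyCoherent 𝒜) ∧
    (GradedRight.HasProcessing 𝒜 1 → GradedRight.GeneratedInDegreeOne 𝒜 →
      GradedRight.UniversallyKoszul 𝒜) ∧
    (GradedRight.IsQuadraticMonomial 𝒜 →
      GradedRight.HasProcessing 𝒜 1 ∧ GradedRight.UniversallyKoszul 𝒜) := by
  refine ⟨fun r H ↦ ?_, fun H H' ↦ H.universallyKoszul hconn H', fun H ↦
    ⟨H.hasProcessing, H.hasProcessing.universallyKoszul hconn H.generatedInDegreeOne⟩⟩
  obtain ⟨n, w, π, N, S⟩ := H.exists_isProcessingBasis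
  -- The argument gives the sharper bound `d + r`.
  have hbound : ∀ d : ℕ, GradedRight.syzygyBound 𝒜 d ≤ ((d + 2 * r : ℕ) : ℕ∞) := fun d ↦
    (S.syzygyBound_le d).trans (Nat.cast_le.2 (by omega))
  refine ⟨hbound, ?_, ?_⟩
  · filter_upwards [Filter.eventually_ge_atTop (2 * r)] with d hd
    exact (hbound d).trans (Nat.cast_le.2 (by omega))
  -- The bound `r ≤ d` admits the colon ideals, and `∑ i, w i ≤ d` admits `R_{≥1}`.
  · filter_upwards [Filter.eventually_ge_atTop r, Filter.eventually_ge_atTop (∑ i, w i)]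
      with d hd hd'
    exact S.universallyDCoherent hconn hd (S.m0_irrelevant_le.trans (Nat.cast_le.2 hd'))
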